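/- All algebras are real, 3-dimensional and commutative (not necessarily associative or unital); an algebra is given by the products of the vectors of a basis $(e_1,e_2,e_3)$. For $\alpha,\beta,a,b\in\mathbb{R}$ put - $A_1(\alpha,\beta)$: $e_1^2=0,\ e_2^2=0,\ e_3^2=e_3,\ e_1e_2=e_3,\ e_1e_3=\alpha e_1,\ e_2e_3=\beta e_2$; - $A_2(\alpha,\beta)$: $e_1^2=0,\ e_2^2=0,\ e_3^2=e_3,\ e_1e_2=0,\ e_1e_3=\alpha e_1,\ e_2e_3=\beta e_2$; - $A_3(\alpha,\beta)$: $e_1^2=0,\ e_2^2=0,\ e_3^2=0,\ e_1e_2=e_3,\ e_1e_3=\alpha e_1,\ e_2e_3=\beta e_2$; - $A_4(\alpha,\beta)$: $e_1^2=0,\ e_2^2=0,\ e_3^2=0,\ e_1e_2=0,\ e_1e_3=\alpha e_1,\ e_2e_3=\beta e_2$; - $A_{22}$: $e_1^2=0,\ e_2^2=0,\ e_3^2=e_3,\ e_1e_2=0,\ e_1e_3=0,\ e_2e_3=e_1$; - $A_5(a,b)$: $e_1^2=0,\ e_2^2=0,\ e_3^2=e_3,\ e_1e_2=0,\ e_1e_3=ae_1-be_2,\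 e_2e_3=be_1+ae_2$; - $A_6(\alpha,\beta)$: $e_1^2=0,\ e_2^2=e_1,\ e_3^2=e_3,\ e_1e_2=0,\ e_1e_3=\alpha e_1,\ e_2e_3=\beta e_2$; - $A_7(\alpha,\beta)$: $e_1^2=e_2,\ e_2^2=0,\ e_3^2=0,\ e_1e_2=0,\ e_1e_3=\alpha e_1,\ e_2e_3=\beta e_2$. Define the classes $\mathbf{A1},\dots,\mathbf{A35}$ as consisting of the algebras that have a basis with one of the following multiplication tables: - $\mathbf{A1}$: $A_1(0,0)$; $\mathbf{A2}$: $A_1(0,\tfrac12)$; $\mathbf{A3}$: $A_1(\tfrac12,\tfrac12)$; $\mathbf{A4}$: $A_1(\alpha,0)$; $\mathbf{A5}$: $A_1(\alpha,\tfrac12)$; $\mathbf{A6}$: $A_1(\alpha,\alpha)$, in the last three with $\alpha\notin\{0,\tfrac12\}$; $\mathbf{A7}$: $A_1(\alpha,\beta)$ with $\alpha<\beta$, $\alpha,\beta\notin\{0,\tfrac12\}$; - $\mathbf{A8}$: $A_2(0,0)$; $\mathbf{A9}$: $A_2(0,\tfrac12)$; $\mathbf{A10}$: $A_2(\tfrac12,\tfrac12)$;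 $\mathbf{A11}$: $A_2(0,\beta)$ with $\beta\notin\{0,\tfrac12\}$; $\mathbf{A12}$: $A_2(\tfrac12,\beta)$ with $\beta\notin\{0,\tfrac12\}$; $\mathbf{A13}$: $A_2(\alpha,\alpha)$ with $\alpha\notin\{0,\tfrac12\}$; $\mathbf{A14}$: $A_2(\alpha,\beta)$ with $\alpha<\beta$, $\alpha,\beta\notin\{0,\tfrac12\}$; - $\mathbf{A15}$: $A_3(0,0)$; $\mathbf{A16}$: $A_3(0,1)$; $\mathbf{A17}$: $A_3(1,1)$; $\mathbf{A18}$: $A_3(1,\beta)$ with $\beta>1$; - $\mathbf{A19}$: $A_4(0,1)$; $\mathbf{A20}$: $A_4(1,1)$; $\mathbf{A21}$: $A_4(1,\beta)$ with $\beta\notin\{0,1\}$; - $\mathbf{A22}$: $A_{22}$; $\mathbf{A23}$: $A_5(a,b)$ with $b>0$; - $\mathbf{A24}$: $A_6(0,\beta)$ with $\beta\notin\{0,\tfrac12\}$; $\mathbf{A25}$: $A_6(0,0)$; $\mathbf{A26}$: $A_6(0,\tfrac12)$; $\mathbf{A27}$: $A_6(\alpha,\beta)$ with $\alpha\neq\beta$,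 $\alpha,\beta\notin\{0,\tfrac12\}$; $\mathbf{A28}$: $A_6(\alpha,\alpha)$ with $\alpha\notin\{0,\tfrac12\}$; $\mathbf{A29}$: $A_6(\alpha,\tfrac12)$ with $\alpha\notin\{0,\tfrac12\}$; $\mathbf{A30}$: $A_6(\tfrac12,\tfrac12)$; $\mathbf{A31}$: $A_6(\tfrac12,\beta)$ with $\beta\notin\{0,\tfrac12\}$; - $\mathbf{A32}$: $A_7(0,0)$; $\mathbf{A33}$: $A_7(1,\beta)$ with $\beta\notin\{0,1\}$; $\mathbf{A34}$: $A_7(1,1)$; $\mathbf{A35}$: $A_7(1,0)$. **Theorem.** For all $i,j\in\{1,\dots,35\}$ with $i\neq j$, no algebra of class $\mathbf{Ai}$ is isomorphic (as a real algebra) to any algebra of class $\mathbf{Aj}$. -/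

import Mathlib

/-! Real three-dimensional commutative (not necessarily associative or unital) algebras given by
multiplication tables. The basis vectors `e₁, e₂, e₃` are `e 0, e 1, e 2`; since the algebras are
commutative, the six products listed determine the whole table. -/

section Tables

variable (A : Type*) [NonUnitalNonAssocCommRing A] [Module ℝ A]

/-- `A` is an algebra `A₁(α, β)`. -/
def IsAlgA1 (α β : ℝ) : Prop :=
  ∃ e : Module.Basis (Fin 3) ℝ A,
    e 0 * e 0 = 0 ∧ e 1 * e 1 = 0 ∧ e 2 * e 2 = e 2 ∧
    e 0 * e 1 = e 2 ∧ e 0 * e 2 = α • e 0 ∧ e 1 * e 2 = β • e 1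

/-- `A` is an algebra `A₂(α, β)`. -/
def IsAlgA2 (α β : ℝ) : Prop :=
  ∃ e : Module.Basis (Fin 3) ℝ A,
    e 0 * e 0 = 0 ∧ e 1 * e 1 = 0 ∧ e 2 * e 2 = e 2 ∧
    e 0 * e 1 = 0 ∧ e 0 * e 2 = α • e 0 ∧ e 1 * e 2 = β • e 1

/-- `A` is an algebra `A₃(α, β)`. -/
def IsAlgA3 (α β : ℝ) : Prop :=
  ∃ e : Module.Basis (Fin 3) ℝ A,
    e 0 * e 0 = 0 ∧ e 1 * e 1 = 0 ∧ e 2 * e 2 = 0 ∧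
    e 0 * e 1 = e 2 ∧ e 0 * e 2 = α • e 0 ∧ e 1 * e 2 = β • e 1

/-- `A` is an algebra `A₄(α, β)`. -/
def IsAlgA4 (α β : ℝ) : Prop :=
  ∃ e : Module.Basis (Fin 3) ℝ A,
    e 0 * e 0 = 0 ∧ e 1 * e 1 = 0 ∧ e 2 * e 2 = 0 ∧
    e 0 * e 1 = 0 ∧ e 0 * e 2 = α • e 0 ∧ e 1 * e 2 = β • e 1

/-- `A` is the algebra whose idempotent `e₃` acts on `span {e₁, e₂}` as a nilpotent Jordan block. -/
def IsAlgJordan : Prop :=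
  ∃ e : Module.Basis (Fin 3) ℝ A,
    e 0 * e 0 = 0 ∧ e 1 * e 1 = 0 ∧ e 2 * e 2 = e 2 ∧
    e 0 * e 1 = 0 ∧ e 0 * e 2 = 0 ∧ e 1 * e 2 = e 0

/-- `A` is an algebra `A₅(a, b)`. -/
def IsAlgA5 (a b : ℝ) : Prop :=
  ∃ e : Module.Basis (Fin 3) ℝ A,
    e 0 * e 0 = 0 ∧ e 1 * e 1 = 0 ∧ e 2 * e 2 = e 2 ∧
    e 0 * e 1 = 0 ∧ e 0 * e 2 = a • e 0 - b • e 1 ∧ e 1 * e 2 = b • e 0 + a • e 1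

/-- `A` is an algebra `A₆(α, β)`. -/
def IsAlgA6 (α β : ℝ) : Prop :=
  ∃ e : Module.Basis (Fin 3) ℝ A,
    e 0 * e 0 = 0 ∧ e 1 * e 1 = e 0 ∧ e 2 * e 2 = e 2 ∧
    e 0 * e 1 = 0 ∧ e 0 * e 2 = α • e 0 ∧ e 1 * e 2 = β • e 1

/-- `A` is an algebra `A₇(α, β)`. -/
def IsAlgA7 (α β : ℝ) : Prop :=
  ∃ e : Module.Basis (Fin 3) ℝ A,
    e 0 * e 0 = e 1 ∧ e 1 * e 1 = 0 ∧ e 2 * e 2 = 0 ∧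
    e 0 * e 1 = 0 ∧ e 0 * e 2 = α • e 0 ∧ e 1 * e 2 = β • e 1

/-- `IsOfClass A i`: the algebra `A` is of class **Ai**, for `i = 1, …, 35`. -/
def IsOfClass : ℕ → Prop
  | 1 => IsAlgA1 A 0 0
  | 2 => IsAlgA1 A 0 (1 / 2)
  | 3 => IsAlgA1 A (1 / 2) (1 / 2)
  | 4 => ∃ α : ℝ, α ≠ 0 ∧ α ≠ 1 / 2 ∧ IsAlgA1 A α 0
  | 5 => ∃ α : ℝ, α ≠ 0 ∧ α ≠ 1 / 2 ∧ IsAlgA1 A α (1 / 2)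
  | 6 => ∃ α : ℝ, α ≠ 0 ∧ α ≠ 1 / 2 ∧ IsAlgA1 A α α
  | 7 => ∃ α β : ℝ, α ≠ 0 ∧ α ≠ 1 / 2 ∧ β ≠ 0 ∧ β ≠ 1 / 2 ∧ α < β ∧ IsAlgA1 A α β
  | 8 => IsAlgA2 A 0 0
  | 9 => IsAlgA2 A 0 (1 / 2)
  | 10 => IsAlgA2 A (1 / 2) (1 / 2)
  | 11 => ∃ β : ℝ, β ≠ 0 ∧ β ≠ 1 / 2 ∧ IsAlgA2 A 0 β
  | 12 => ∃ β : ℝ, β ≠ 0 ∧ β ≠ 1 / 2 ∧ IsAlgA2 A (1 / 2) β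
  | 13 => ∃ α : ℝ, α ≠ 0 ∧ α ≠ 1 / 2 ∧ IsAlgA2 A α α
  | 14 => ∃ α β : ℝ, α ≠ 0 ∧ α ≠ 1 / 2 ∧ β ≠ 0 ∧ β ≠ 1 / 2 ∧ α < β ∧ IsAlgA2 A α β
  | 15 => IsAlgA3 A 0 0
  | 16 => IsAlgA3 A 0 1
  | 17 => IsAlgA3 A 1 1
  | 18 => ∃ β : ℝ, 1 < β ∧ IsAlgA3 A 1 β
  | 19 => IsAlgA4 A 0 1
  | 20 => IsAlgA4 A 1 1
  | 21 => ∃ β : ℝ, β ≠ 0 ∧ β ≠ 1 ∧ IsAlgA4 A 1 β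
  | 22 => IsAlgJordan A
  | 23 => ∃ a b : ℝ, 0 < b ∧ IsAlgA5 A a b
  | 24 => ∃ β : ℝ, β ≠ 0 ∧ β ≠ 1 / 2 ∧ IsAlgA6 A 0 β
  | 25 => IsAlgA6 A 0 0
  | 26 => IsAlgA6 A 0 (1 / 2)
  | 27 => ∃ α β : ℝ, α ≠ 0 ∧ α ≠ 1 / 2 ∧ β ≠ 0 ∧ β ≠ 1 / 2 ∧ α ≠ β ∧ IsAlgA6 A α β
  | 28 => ∃ α : ℝ, α ≠ 0 ∧ α ≠ 1 / 2 ∧ IsAlgA6 A α α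
  | 29 => ∃ α : ℝ, α ≠ 0 ∧ α ≠ 1 / 2 ∧ IsAlgA6 A α (1 / 2)
  | 30 => IsAlgA6 A (1 / 2) (1 / 2)
  | 31 => ∃ β : ℝ, β ≠ 0 ∧ β ≠ 1 / 2 ∧ IsAlgA6 A (1 / 2) β
  | 32 => IsAlgA7 A 0 0
  | 33 => ∃ β : ℝ, β ≠ 0 ∧ β ≠ 1 ∧ IsAlgA7 A 1 β
  | 34 => IsAlgA7 A 1 1
  | 35 => IsAlgA7 A 1 0
  | _ => False

end Tables

/-- Isomorphism of real algebras: a linear bijection preserving products. -/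
def AlgIsomorphic (A B : Type*) [NonUnitalNonAssocCommRing A] [Module ℝ A]
    [NonUnitalNonAssocCommRing B] [Module ℝ B] : Prop :=
  ∃ f : A ≃ₗ[ℝ] B, ∀ x y : A, f (x * y) = f x * f y

/-! Being of class **Ai** transports along isomorphisms, so it suffices that one algebra cannot lie
in two classes. Isomorphism-invariant properties, phrased through idempotents and vectors of square
zero (null vectors), split the classes into five families (`IsOfClass.family`): A1–A7; A8–A14 with
A22, A23; A24–A31; A17 alone; and the ten classes without an idempotent.

In the first three families the null vectors and idempotents nearly determine the basis, so the
parameters can be recovered: the unordered pair {α, β} for A₁ (`parameters_eq_or_swap`), the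
similarity class of the idempotent's action on the null plane for A₂, A₅ and A22 (`similar`), the
ordered pair (α, β) for A₆ (`parameters_eq`). The parameter ranges are disjoint in this sense. The
ten classes without an idempotent are told apart by further yes/no invariants
(`invariants_without_idempotent`). -/

section Invariants

variable (A : Type*) [NonUnitalNonAssocCommRing A] [Module ℝ A]

/-- Some nonzero idempotent exists. -/
def HasIdempotent : Prop := ∃ p : A, p ≠ 0 ∧ p * p = p

/-- Some nonzero idempotent is a product of two vectors of square zero. -/
def HasNullFactoredIdempotent : Prop :=
  ∃ x y : A, x * x = 0 ∧ y * y = 0 ∧ x * y ≠ 0 ∧ (x * y) * (x * y) = x * y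

/-- There are two linearly independent vectors of square zero. -/
def HasNullPair : Prop :=
  ∃ x y : A, LinearIndependent ℝ ![x, y] ∧ x * x = 0 ∧ y * y = 0

/-- There is a two-dimensional subspace on which the product vanishes. -/
def HasNullPlane : Prop :=
  ∃ x y : A, LinearIndependent ℝ ![x, y] ∧ x * x = 0 ∧ y * y = 0 ∧ x * y = 0

/-- All products of three factors vanish. -/
def TripleProductsVanish : Prop := ∀ x y z : A, (x * y) * z = 0

/-- All products of two products vanish. -/
def IsMetabelian : Prop := ∀ x y z w : A, (x * y) * (z * w) = 0

/-- The annihilator is nonzero. -/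
def HasAnnihilator : Prop := ∃ x : A, x ≠ 0 ∧ ∀ y, x * y = 0

/-- The annihilator contains two linearly independent vectors. -/
def HasAnnihilatorPair : Prop :=
  ∃ x y : A, LinearIndependent ℝ ![x, y] ∧ ∀ z, x * z = 0 ∧ y * z = 0

/-- Some nonzero square lies in the annihilator. -/
def HasSquareAnnihilator : Prop := ∃ x : A, x * x ≠ 0 ∧ ∀ y, (x * x) * y = 0

/-- Some multiplication operator fixes two linearly independent vectors. -/
def FixesPair : Prop :=
  ∃ z x y : A, LinearIndependent ℝ ![x, y] ∧ z * x = x ∧ z * y = y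

/-- There are three vectors of square zero whose pairwise products are nonzero. -/
def HasNullTriangle : Prop :=
  ∃ x y z : A, x * x = 0 ∧ y * y = 0 ∧ z * z = 0 ∧ x * y ≠ 0 ∧ x * z ≠ 0 ∧ y * z ≠ 0

end Invariants

/-! ### Coordinates and products for the common table shape. -/

section Table

variable {A : Type*} [NonUnitalNonAssocCommRing A] [Module ℝ A]

/-- The common shape of all multiplication tables considered. -/
structure IsTable (e : Module.Basis (Fin 3) ℝ A) (κ ι ε δ a b c d : ℝ) : Prop where
  h00 : e 0 * e 0 = κ • e 1
  h11 : e 1 * e 1 = ι • e 0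
  h22 : e 2 * e 2 = ε • e 2
  h01 : e 0 * e 1 = δ • e 2
  h02 : e 0 * e 2 = a • e 0 + c • e 1
  h12 : e 1 * e 2 = b • e 0 + d • e 1

theorem Module.Basis.eq_zero_iff_three (e : Module.Basis (Fin 3) ℝ A) (x : A) :
    x = 0 ↔ e.repr x 0 = 0 ∧ e.repr x 1 = 0 ∧ e.repr x 2 = 0 := by
  rw [← e.repr.map_eq_zero_iff, Finsupp.ext_iff]
  simp [Fin.forall_fin_succ]

theorem Module.Basis.eq_iff_three (e : Module.Basis (Fin 3) ℝ A) (x y : A) :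
    x = y ↔ e.repr x 0 = e.repr y 0 ∧ e.repr x 1 = e.repr y 1 ∧ e.repr x 2 = e.repr y 2 := by
  rw [← e.repr.injective.eq_iff, Finsupp.ext_iff]
  simp [Fin.forall_fin_succ]

theorem Module.Basis.pair_linearIndependent_iff (e : Module.Basis (Fin 3) ℝ A) (x y : A) :
    LinearIndependent ℝ ![x, y] ↔ ∀ s t : ℝ,
      s * e.repr x 0 + t * e.repr y 0 = 0 → s * e.repr x 1 + t * e.repr y 1 = 0 →
      s * e.repr x 2 + t * e.repr y 2 = 0 → s = 0 ∧ t = 0 := by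
  rw [LinearIndependent.pair_iff]
  refine forall₂_congr fun s t => ?_
  rw [e.eq_zero_iff_three]
  simp

theorem Module.Basis.pair_linearIndependent (e : Module.Basis (Fin 3) ℝ A) {i j : Fin 3}
    (h : i ≠ j) : LinearIndependent ℝ ![e i, e j] := by
  have := e.linearIndependent.comp ![i, j] (by
    intro a b; fin_cases a <;> fin_cases b <;> simp [h, h.symm])
  convert this using 1
  ext k; fin_cases k <;> rfl

namespace IsTable

variable [IsScalarTower ℝ A A] [SMulCommClass ℝ A A]
  {e : Module.Basis (Fin 3) ℝ A} {κ ι ε δ a b c d : ℝ}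

theorem mul_eq (h : IsTable e κ ι ε δ a b c d) (x y : A) :
    x * y =
      (ι * (e.repr x 1 * e.repr y 1) + a * (e.repr x 0 * e.repr y 2 + e.repr x 2 * e.repr y 0)
        + b * (e.repr x 1 * e.repr y 2 + e.repr x 2 * e.repr y 1)) • e 0 +
      (κ * (e.repr x 0 * e.repr y 0) + c * (e.repr x 0 * e.repr y 2 + e.repr x 2 * e.repr y 0)
        + d * (e.repr x 1 * e.repr y 2 + e.repr x 2 * e.repr y 1)) • e 1 +
      (ε * (e.repr x 2 * e.repr y 2) +
        δ * (e.repr x 0 * e.repr y 1 + e.repr x 1 * e.repr y 0)) • e 2 := by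
  have hx := e.sum_repr x
  have hy := e.sum_repr y
  rw [Fin.sum_univ_three] at hx hy
  conv_lhs => rw [← hx, ← hy]
  simp only [add_mul, mul_add, smul_mul_assoc, mul_smul_comm, mul_comm (e 1) (e 0),
    mul_comm (e 2) (e 0), mul_comm (e 2) (e 1), h.h00, h.h11, h.h22, h.h01, h.h02, h.h12]
  module

theorem repr_mul_zero (h : IsTable e κ ι ε δ a b c d) (x y : A) :
    e.repr (x * y) 0 =
      ι * (e.repr x 1 * e.repr y 1) + a * (e.repr x 0 * e.repr y 2 + e.repr x 2 * e.repr y 0)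
        + b * (e.repr x 1 * e.repr y 2 + e.repr x 2 * e.repr y 1) := by
  conv_lhs => rw [h.mul_eq]
  simp

theorem repr_mul_one (h : IsTable e κ ι ε δ a b c d) (x y : A) :
    e.repr (x * y) 1 =
      κ * (e.repr x 0 * e.repr y 0) + c * (e.repr x 0 * e.repr y 2 + e.repr x 2 * e.repr y 0)
        + d * (e.repr x 1 * e.repr y 2 + e.repr x 2 * e.repr y 1) := by
  conv_lhs => rw [h.mul_eq]
  simp

theorem repr_mul_two (h : IsTable e κ ι ε δ a b c d) (x y : A) :
    e.repr (x * y) 2 =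
      ε * (e.repr x 2 * e.repr y 2) +
        δ * (e.repr x 0 * e.repr y 1 + e.repr x 1 * e.repr y 0) := by
  conv_lhs => rw [h.mul_eq]
  simp

end IsTable

end Table

/-! ### Transport of classes along isomorphisms. -/

section Transport

variable {A B : Type*} [NonUnitalNonAssocCommRing A] [Module ℝ A]
  [NonUnitalNonAssocCommRing B] [Module ℝ B]

theorem IsOfClass.of_linearEquiv {j : ℕ} (hB : IsOfClass B j) (f : A ≃ₗ[ℝ] B)
    (hf : ∀ x y : A, f (x * y) = f x * f y) : IsOfClass A j := by
  have hg : ∀ x y : B, f.symm x * f.symm y = f.symm (x * y) := fun x y =>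
    f.injective (by simp [hf])
  have h1 : ∀ α β, IsAlgA1 B α β → IsAlgA1 A α β := by
    rintro α β ⟨e, h⟩; refine ⟨e.map f.symm, ?_⟩; simp [hg, h]
  have h2 : ∀ α β, IsAlgA2 B α β → IsAlgA2 A α β := by
    rintro α β ⟨e, h⟩; refine ⟨e.map f.symm, ?_⟩; simp [hg, h]
  have h3 : ∀ α β, IsAlgA3 B α β → IsAlgA3 A α β := by
    rintro α β ⟨e, h⟩; refine ⟨e.map f.symm, ?_⟩; simp [hg, h]
  have h4 : ∀ α β, IsAlgA4 B α β → IsAlgA4 A α β := by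
    rintro α β ⟨e, h⟩; refine ⟨e.map f.symm, ?_⟩; simp [hg, h]
  have h5 : ∀ α β, IsAlgA5 B α β → IsAlgA5 A α β := by
    rintro α β ⟨e, h⟩; refine ⟨e.map f.symm, ?_⟩; simp [hg, h]
  have h6 : ∀ α β, IsAlgA6 B α β → IsAlgA6 A α β := by
    rintro α β ⟨e, h⟩; refine ⟨e.map f.symm, ?_⟩; simp [hg, h]
  have h7 : ∀ α β, IsAlgA7 B α β → IsAlgA7 A α β := by
    rintro α β ⟨e, h⟩; refine ⟨e.map f.symm, ?_⟩; simp [hg, h]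
  have hJ : IsAlgJordan B → IsAlgJordan A := by
    rintro ⟨e, h⟩; refine ⟨e.map f.symm, ?_⟩; simp [hg, h]
  unfold IsOfClass at hB ⊢
  split at hB <;> first | exact hB.elim | tauto | skip
  all_goals grind

end Transport

theorem HasNullFactoredIdempotent.hasIdempotent {A : Type*} [NonUnitalNonAssocCommRing A]
    (h : HasNullFactoredIdempotent A) : HasIdempotent A :=
  let ⟨x, y, _, _, hne, hid⟩ := h; ⟨x * y, hne, hid⟩

/-! ### Invariants read off from the tables. -/

section TableInvariants

variable {A : Type*} [NonUnitalNonAssocCommRing A] [Module ℝ A]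

theorem HasNullPlane.hasNullPair (h : HasNullPlane A) : HasNullPair A :=
  let ⟨x, y, hli, hx, hy, _⟩ := h; ⟨x, y, hli, hx, hy⟩

theorem isAlgA1_iff {α β : ℝ} :
    IsAlgA1 A α β ↔ ∃ e : Module.Basis (Fin 3) ℝ A, IsTable e 0 0 1 1 α 0 0 β :=
  exists_congr fun e => ⟨fun ⟨h0, h1, h2, h3, h4, h5⟩ => by constructor <;> simp [*],
    fun ⟨h0, h1, h2, h3, h4, h5⟩ => by simp [*]⟩

theorem isAlgA2_iff {α β : ℝ} :
    IsAlgA2 A α β ↔ ∃ e : Module.Basis (Fin 3) ℝ A, IsTable e 0 0 1 0 α 0 0 β :=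
  exists_congr fun e => ⟨fun ⟨h0, h1, h2, h3, h4, h5⟩ => by constructor <;> simp [*],
    fun ⟨h0, h1, h2, h3, h4, h5⟩ => by simp [*]⟩

theorem isAlgA3_iff {α β : ℝ} :
    IsAlgA3 A α β ↔ ∃ e : Module.Basis (Fin 3) ℝ A, IsTable e 0 0 0 1 α 0 0 β :=
  exists_congr fun e => ⟨fun ⟨h0, h1, h2, h3, h4, h5⟩ => by constructor <;> simp [*],
    fun ⟨h0, h1, h2, h3, h4, h5⟩ => by simp [*]⟩

theorem isAlgA4_iff {α β : ℝ} :
    IsAlgA4 A α β ↔ ∃ e : Module.Basis (Fin 3) ℝ A, IsTable e 0 0 0 0 α 0 0 β :=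
  exists_congr fun e => ⟨fun ⟨h0, h1, h2, h3, h4, h5⟩ => by constructor <;> simp [*],
    fun ⟨h0, h1, h2, h3, h4, h5⟩ => by simp [*]⟩

theorem isAlgJordan_iff :
    IsAlgJordan A ↔ ∃ e : Module.Basis (Fin 3) ℝ A, IsTable e 0 0 1 0 0 1 0 0 :=
  exists_congr fun e => ⟨fun ⟨h0, h1, h2, h3, h4, h5⟩ => by constructor <;> simp [*],
    fun ⟨h0, h1, h2, h3, h4, h5⟩ => by simp [*]⟩

theorem isAlgA5_iff {a b : ℝ} :
    IsAlgA5 A a b ↔ ∃ e : Module.Basis (Fin 3) ℝ A, IsTable e 0 0 1 0 a b (-b) a :=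
  exists_congr fun e =>
    ⟨fun ⟨h0, h1, h2, h3, h4, h5⟩ => by constructor <;> simp [*, sub_eq_add_neg],
      fun ⟨h0, h1, h2, h3, h4, h5⟩ => by simp [*, sub_eq_add_neg]⟩

theorem isAlgA6_iff {α β : ℝ} :
    IsAlgA6 A α β ↔ ∃ e : Module.Basis (Fin 3) ℝ A, IsTable e 0 1 1 0 α 0 0 β :=
  exists_congr fun e => ⟨fun ⟨h0, h1, h2, h3, h4, h5⟩ => by constructor <;> simp [*],
    fun ⟨h0, h1, h2, h3, h4, h5⟩ => by simp [*]⟩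

theorem isAlgA7_iff {α β : ℝ} :
    IsAlgA7 A α β ↔ ∃ e : Module.Basis (Fin 3) ℝ A, IsTable e 1 0 0 0 α 0 0 β :=
  exists_congr fun e => ⟨fun ⟨h0, h1, h2, h3, h4, h5⟩ => by constructor <;> simp [*],
    fun ⟨h0, h1, h2, h3, h4, h5⟩ => by simp [*]⟩

namespace IsTable

variable {e e' : Module.Basis (Fin 3) ℝ A}
  {κ ι ε δ a b c d a' b' c' d' α β α' β' : ℝ}

theorem hasIdempotent (h : IsTable e κ ι 1 δ a b c d) : HasIdempotent A :=
  ⟨e 2, e.ne_zero 2, by simp [h.h22]⟩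

theorem hasNullFactoredIdempotent (h : IsTable e 0 0 1 1 a b c d) :
    HasNullFactoredIdempotent A :=
  ⟨e 0, e 1, by simp [h.h00], by simp [h.h11], by simp [h.h01, e.ne_zero 2],
    by simp [h.h01, h.h22]⟩

theorem hasNullPlane (h : IsTable e 0 0 ε 0 a b c d) : HasNullPlane A :=
  ⟨e 0, e 1, e.pair_linearIndependent (by decide), by simp [h.h00], by simp [h.h11],
    by simp [h.h01]⟩

theorem hasNullPlane_of_zero_two (h : IsTable e 0 ι 0 δ 0 b 0 d) : HasNullPlane A :=
  ⟨e 0, e 2, e.pair_linearIndependent (by decide), by simp [h.h00], by simp [h.h22],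
    by simp [h.h02]⟩

theorem hasNullPair (h : IsTable e 0 0 ε δ a b c d) : HasNullPair A :=
  ⟨e 0, e 1, e.pair_linearIndependent (by decide), by simp [h.h00], by simp [h.h11]⟩

theorem hasNullTriangle (h : IsTable e 0 0 0 1 α 0 0 β) (hα : α ≠ 0) (hβ : β ≠ 0) :
    HasNullTriangle A :=
  ⟨e 0, e 1, e 2, by simp [h.h00], by simp [h.h11], by simp [h.h22],
    by simp [h.h01, e.ne_zero], by simp [h.h02, e.ne_zero, hα], by simp [h.h12, e.ne_zero, hβ]⟩

theorem hasNullPlane_of_right_zero (h : IsTable e κ 0 0 0 a 0 0 0) : HasNullPlane A :=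
  ⟨e 1, e 2, e.pair_linearIndependent (by decide), by simp [h.h11], by simp [h.h22],
    by simp [h.h12]⟩

theorem not_tripleProductsVanish_of_left (h : IsTable e κ ι ε δ 1 b 0 d) :
    ¬ TripleProductsVanish A := fun H => by
  have := H (e 0) (e 2) (e 2)
  simp [h.h02, e.ne_zero] at this

theorem not_tripleProductsVanish_of_right (h : IsTable e κ ι ε δ a 0 c 1) :
    ¬ TripleProductsVanish A := fun H => by
  have := H (e 1) (e 2) (e 2)
  simp [h.h12, e.ne_zero] at this

theorem not_isMetabelian (h : IsTable e 0 0 0 1 0 0 0 1) : ¬ IsMetabelian A := fun H => by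
  have := H (e 0) (e 1) (e 1) (e 2)
  rw [h.h01, h.h12] at this
  simp [mul_comm (e 2), h.h12, e.ne_zero] at this

theorem fixesPair (h : IsTable e κ ι ε δ 1 0 0 1) : FixesPair A :=
  ⟨e 2, e 0, e 1, e.pair_linearIndependent (by decide), by simp [mul_comm (e 2), h.h02],
    by simp [mul_comm (e 2), h.h12]⟩

variable [IsScalarTower ℝ A A] [SMulCommClass ℝ A A]

theorem mul_self_eq_zero_iff (h : IsTable e κ ι ε δ a b c d) (x : A) :
    x * x = 0 ↔
      ι * e.repr x 1 ^ 2 + 2 * e.repr x 2 * (a * e.repr x 0 + b * e.repr x 1) = 0 ∧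
      κ * e.repr x 0 ^ 2 + 2 * e.repr x 2 * (c * e.repr x 0 + d * e.repr x 1) = 0 ∧
      ε * e.repr x 2 ^ 2 + 2 * δ * (e.repr x 0 * e.repr x 1) = 0 := by
  rw [e.eq_zero_iff_three, h.repr_mul_zero, h.repr_mul_one, h.repr_mul_two]
  ring_nf

/-- Null vectors lie in the span of `e 0` and `e 1`. This plane is closed under products, and its
only products are multiples of `e 0`, which squares to zero; so it contains no nonzero idempotent.
-/
theorem not_hasNullFactoredIdempotent (h : IsTable e 0 ι 1 0 a b c d) :
    ¬ HasNullFactoredIdempotent A := by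
  rintro ⟨x, y, hx, hy, hne, hid⟩
  rw [h.mul_self_eq_zero_iff] at hx hy
  have hx2 : e.repr x 2 = 0 := by simpa using hx.2.2
  have hp : e.repr (x * y) 2 = 0 := by simp [h.repr_mul_two, hx2]
  have h0 := h.repr_mul_zero (x * y) (x * y)
  have h1 := h.repr_mul_one (x * y) (x * y)
  rw [hid] at h0 h1
  simp only [hp] at h0 h1
  have h1' : e.repr (x * y) 1 = 0 := by simpa using h1
  exact hne ((e.eq_zero_iff_three _).2 ⟨by simpa [h1'] using h0, h1', hp⟩)

theorem not_hasIdempotent (h : IsTable e κ 0 0 0 a b c d) : ¬ HasIdempotent A := by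
  rintro ⟨p, hne, hid⟩
  have h0 := h.repr_mul_zero p p
  have h1 := h.repr_mul_one p p
  have h2 := h.repr_mul_two p p
  rw [hid] at h0 h1 h2
  have h2' : e.repr p 2 = 0 := by simpa using h2
  have h0' : e.repr p 0 = 0 := by simpa [h2'] using h0
  exact hne ((e.eq_zero_iff_three _).2 ⟨h0', by simpa [h0', h2'] using h1, h2'⟩)

/-- Idempotency reads p₀ = 2a p₀p₂, p₁ = 2d p₁p₂, p₂ = 2p₀p₁. If p₀p₁ = 0 everything vanishes;
otherwise 2a p₂ = 1 = 2d p₂, which forces a = d ≠ 0. -/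
theorem not_hasIdempotent_of_ne (h : IsTable e 0 0 0 1 a 0 0 d) (had : a ≠ d ∨ a = 0) :
    ¬ HasIdempotent A := by
  rintro ⟨p, hne, hid⟩
  have h0 := h.repr_mul_zero p p
  have h1 := h.repr_mul_one p p
  have h2 := h.repr_mul_two p p
  rw [hid] at h0 h1 h2
  rw [Ne, e.eq_zero_iff_three] at hne
  grind

theorem hasIdempotent_of_eq_one (h : IsTable e 0 0 0 1 1 0 0 1) : HasIdempotent A := by
  -- With both parameters 1, the equations p₀ = 2p₀p₂, p₁ = 2p₁p₂, p₂ = 2p₀p₁ are solved by p₀ = p₁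
  -- = p₂ = 1/2.
  refine ⟨(1 / 2 : ℝ) • (e 0 + e 1 + e 2), ?_, ?_⟩
  · rw [Ne, e.eq_zero_iff_three]
    simp
  · rw [e.eq_iff_three, h.repr_mul_zero, h.repr_mul_one, h.repr_mul_two]
    simp
    norm_num

/-- The null vectors are exactly those on the three coordinate axes. Products of axis vectors again
lie on an axis, and nonzero vectors on different axes have nonzero product. -/
theorem null_of_axes (h : IsTable e 0 0 0 1 α 0 0 β) (hα : α ≠ 0) (hβ : β ≠ 0) {x : A}
    (hx : x * x = 0) :
    e.repr x 0 * e.repr x 1 = 0 ∧ e.repr x 0 * e.repr x 2 = 0 ∧ e.repr x 1 * e.repr x 2 = 0 := by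
  rw [h.mul_self_eq_zero_iff] at hx
  grind

theorem not_hasNullFactoredIdempotent_of_axes (h : IsTable e 0 0 0 1 α 0 0 β) (hα : α ≠ 0)
    (hβ : β ≠ 0) : ¬ HasNullFactoredIdempotent A := by
  rintro ⟨x, y, hx, hy, hne, hid⟩
  have hx' := h.null_of_axes hα hβ hx
  have hy' := h.null_of_axes hα hβ hy
  have hp : (x * y) * (x * y) = 0 := by
    rw [h.mul_self_eq_zero_iff, h.repr_mul_zero, h.repr_mul_one, h.repr_mul_two]
    grind
  exact hne (hid ▸ hp)

theorem not_hasNullPlane_of_axes (h : IsTable e 0 0 0 1 α 0 0 β) (hα : α ≠ 0)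
    (hβ : β ≠ 0) : ¬ HasNullPlane A := by
  rintro ⟨x, y, hli, hx, hy, hxy⟩
  have hx' := h.null_of_axes hα hβ hx
  have hy' := h.null_of_axes hα hβ hy
  rw [e.eq_zero_iff_three, h.repr_mul_zero, h.repr_mul_one, h.repr_mul_two] at hxy
  rw [e.pair_linearIndependent_iff] at hli
  -- These coefficients cancel one coordinate of the combination of x and y; the pair (1, 0) records
  -- x ≠ 0. The same instances express independence in later proofs.
  have h0 := hli (e.repr y 0) (-e.repr x 0)
  have h1 := hli (e.repr y 1) (-e.repr x 1)
  have h2 := hli (e.repr y 2) (-e.repr x 2)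
  have h3 := hli 1 0
  grind

/-- All null vectors are multiples of `e 0`. -/
theorem not_hasNullPair (h : IsTable e 0 1 1 0 a b c d) : ¬ HasNullPair A := by
  rintro ⟨x, y, hli, hx, hy⟩
  rw [h.mul_self_eq_zero_iff] at hx hy
  rw [e.pair_linearIndependent_iff] at hli
  have h0 := hli (e.repr y 0) (-e.repr x 0)
  have h3 := hli 1 0
  grind

/-- Null vectors lie on just two axes, those of `e 1` and `e 2`. Among three of them two share an
axis, and their product vanishes. -/
theorem not_hasNullTriangle (h : IsTable e 1 0 0 0 1 0 0 d) (hd : d ≠ 0) :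
    ¬ HasNullTriangle A := by
  rintro ⟨x, y, z, hx, hy, hz, hxy, hxz, hyz⟩
  rw [h.mul_self_eq_zero_iff] at hx hy hz
  rw [Ne, e.eq_zero_iff_three, h.repr_mul_zero, h.repr_mul_one, h.repr_mul_two] at hxy hxz hyz
  have hx0 : e.repr x 0 = 0 := by grind
  have hy0 : e.repr y 0 = 0 := by grind
  have hz0 : e.repr z 0 = 0 := by grind
  simp only [hx0, hy0, hz0] at *
  have hx' : e.repr x 1 = 0 ∨ e.repr x 2 = 0 := by grind
  have hy' : e.repr y 1 = 0 ∨ e.repr y 2 = 0 := by grind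
  have hz' : e.repr z 1 = 0 ∨ e.repr z 2 = 0 := by grind
  rcases hx' with hx' | hx' <;> rcases hy' with hy' | hy' <;> rcases hz' with hz' | hz' <;>
    simp_all

theorem not_hasNullPlane (h : IsTable e 1 0 0 0 1 0 0 d) (hd : d ≠ 0) : ¬ HasNullPlane A := by
  rintro ⟨x, y, hli, hx, hy, hxy⟩
  rw [h.mul_self_eq_zero_iff] at hx hy
  rw [e.eq_zero_iff_three, h.repr_mul_zero, h.repr_mul_one, h.repr_mul_two] at hxy
  rw [e.pair_linearIndependent_iff] at hli
  have hx0 : e.repr x 0 = 0 := by grind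
  have hy0 : e.repr y 0 = 0 := by grind
  have h1 := hli (e.repr y 1) (-e.repr x 1)
  have h2 := hli (e.repr y 2) (-e.repr x 2)
  have h3 := hli 1 0
  simp only [hx0, hy0] at *
  grind

/-- If κ and δ were both nonzero, (e₁e₁)e₁ = κδ e₃ would survive; with one of them zero, all
products lie in the annihilator. -/
theorem tripleProductsVanish (h : IsTable e κ 0 0 δ 0 0 0 0) (hκδ : κ = 0 ∨ δ = 0) :
    TripleProductsVanish A := by
  intro x y z
  rw [e.eq_zero_iff_three]
  simp only [h.repr_mul_zero, h.repr_mul_one, h.repr_mul_two]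
  grind

theorem hasAnnihilatorPair (h : IsTable e κ 0 0 0 0 0 0 0) : HasAnnihilatorPair A := by
  refine ⟨e 1, e 2, e.pair_linearIndependent (by decide), fun z => ?_⟩
  simp [e.eq_zero_iff_three, h.repr_mul_zero, h.repr_mul_one, h.repr_mul_two]

theorem not_hasAnnihilatorPair (h : IsTable e 0 0 0 1 0 0 0 0) : ¬ HasAnnihilatorPair A := by
  rintro ⟨x, y, hli, hz⟩
  have h0 := hz (e 0)
  have h1 := hz (e 1)
  rw [e.pair_linearIndependent_iff] at hli
  simp [e.eq_zero_iff_three, h.repr_mul_zero, h.repr_mul_one, h.repr_mul_two] at h0 h1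
  have h2 := hli (e.repr y 2) (-e.repr x 2)
  have h3 := hli 1 0
  grind

theorem hasAnnihilator_of_left (h : IsTable e 0 ι ε 0 0 b 0 d) : HasAnnihilator A := by
  refine ⟨e 0, e.ne_zero 0, fun z => ?_⟩
  simp [e.eq_zero_iff_three, h.repr_mul_zero, h.repr_mul_one, h.repr_mul_two]

theorem hasAnnihilator_of_right (h : IsTable e κ 0 ε 0 a 0 c 0) : HasAnnihilator A := by
  refine ⟨e 1, e.ne_zero 1, fun z => ?_⟩
  simp [e.eq_zero_iff_three, h.repr_mul_zero, h.repr_mul_one, h.repr_mul_two]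

theorem not_hasAnnihilator (h : IsTable e 0 0 0 δ α 0 0 β) (hβ : β ≠ 0) (hα : α ≠ 0 ∨ δ ≠ 0) :
    ¬ HasAnnihilator A := by
  rintro ⟨x, hx, hz⟩
  have h0 := hz (e 0)
  have h1 := hz (e 1)
  have h2 := hz (e 2)
  rw [Ne, e.eq_zero_iff_three] at hx
  simp [e.eq_zero_iff_three, h.repr_mul_zero, h.repr_mul_one, h.repr_mul_two] at h0 h1 h2
  grind

theorem hasSquareAnnihilator (h : IsTable e 1 0 ε 0 a 0 c 0) : HasSquareAnnihilator A := by
  refine ⟨e 0, by simp [h.h00, e.ne_zero], fun z => ?_⟩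
  simp [e.eq_zero_iff_three, h.repr_mul_zero, h.repr_mul_one, h.repr_mul_two]

theorem not_hasSquareAnnihilator (h : IsTable e 0 0 0 0 0 0 0 1) :
    ¬ HasSquareAnnihilator A := by
  rintro ⟨x, hx, hz⟩
  have h2 := hz (e 2)
  simp [e.eq_zero_iff_three, h.repr_mul_zero, h.repr_mul_one, h.repr_mul_two] at h2 hx
  grind

theorem isMetabelian (h : IsTable e 0 0 0 0 a b c d) : IsMetabelian A := by
  intro x y z w
  simp [e.eq_zero_iff_three, h.repr_mul_zero, h.repr_mul_one, h.repr_mul_two]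

/-- Fixed vectors are products, hence lie in the span of `e 0` and `e 1`, where z acts triangularly
with diagonal z₂, βz₂. Fixing two independent vectors makes this action the identity, so β = 1. -/
theorem not_fixesPair (h : IsTable e κ 0 0 0 1 0 0 β) (hβ : β ≠ 1) : ¬ FixesPair A := by
  rintro ⟨z, x, y, hli, hx, hy⟩
  rw [e.pair_linearIndependent_iff] at hli
  rw [e.eq_iff_three, h.repr_mul_zero, h.repr_mul_one, h.repr_mul_two] at hx hy
  have h0 := hli (e.repr y 0) (-e.repr x 0)
  have h1 := hli (e.repr y 1) (-e.repr x 1)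
  have h3 := hli 1 0
  have hx2 : e.repr x 2 = 0 := by linarith [hx.2.2]
  have hy2 : e.repr y 2 = 0 := by linarith [hy.2.2]
  simp only [hx2, hy2] at *
  grind

end IsTable

end TableInvariants

/-! ### Recovering the parameters from the algebra. -/

section Parameters

variable {A : Type*} [NonUnitalNonAssocCommRing A] [Module ℝ A]
  [IsScalarTower ℝ A A] [SMulCommClass ℝ A A]

namespace IsTable

variable {e e' : Module.Basis (Fin 3) ℝ A} {a b c d a' b' c' d' α β α' β' : ℝ}

/-- For α = β = 0 the null vectors fill the whole cone x₂² + 2x₀x₁ = 0; a nonzero parameter cuts it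
down to two axes. -/
theorem null_of_isotropic_pair (h : IsTable e 0 0 1 1 α 0 0 β) (hne : α ≠ 0 ∨ β ≠ 0) {x : A}
    (hx : x * x = 0) : e.repr x 2 = 0 ∧ e.repr x 0 * e.repr x 1 = 0 := by
  rw [h.mul_self_eq_zero_iff] at hx
  grind

/-- The null vectors `e' 0` and `e' 1` have nonzero product, so they lie on the two different axes
of `e 0` and `e 1`. Their product is an idempotent multiple of `e 2`, hence `e 2` itself, and the
parameters are its eigenvalues on those axes. -/
theorem parameters_eq_or_swap_of_ne_zero (h : IsTable e 0 0 1 1 α 0 0 β)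
    (h' : IsTable e' 0 0 1 1 α' 0 0 β') (hne : α ≠ 0 ∨ β ≠ 0) :
    (α' = α ∧ β' = β) ∨ (α' = β ∧ β' = α) := by
  have hp := h.null_of_isotropic_pair hne (x := e' 0) (by simp [h'.h00])
  have hq := h.null_of_isotropic_pair hne (x := e' 1) (by simp [h'.h11])
  have hr : e' 2 = e' 0 * e' 1 := by simp [h'.h01]
  have hrne := e'.ne_zero 2
  have hrr : e' 2 * e' 2 = e' 2 := by simp [h'.h22]
  have hpr : e' 0 * e' 2 = α' • e' 0 := by simp [h'.h02]
  have hqr : e' 1 * e' 2 = β' • e' 1 := by simp [h'.h12]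
  generalize e' 0 = p at *
  generalize e' 1 = q at *
  generalize e' 2 = r at *
  rw [Ne, e.eq_zero_iff_three] at hrne
  rw [e.eq_iff_three, h.repr_mul_zero, h.repr_mul_one, h.repr_mul_two] at hr hrr hpr hqr
  obtain ⟨hp2, hp01⟩ := hp
  obtain ⟨hq2, hq01⟩ := hq
  simp only [map_smul, Finsupp.smul_apply, smul_eq_mul, hp2, hq2, mul_zero, zero_mul, add_zero,
    zero_add, one_mul] at hr hrr hpr hqr hrne
  obtain ⟨hr0, hr1, hr2⟩ := hr
  have hr2' : e.repr r 2 = 1 := by grind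
  simp only [hr0, hr1, hr2', mul_zero, mul_one, zero_add] at hpr hqr hr2
  grind

theorem parameters_eq_or_swap (h : IsTable e 0 0 1 1 α 0 0 β)
    (h' : IsTable e' 0 0 1 1 α' 0 0 β') : (α' = α ∧ β' = β) ∨ (α' = β ∧ β' = α) := by
  by_cases hne : α ≠ 0 ∨ β ≠ 0
  · exact h.parameters_eq_or_swap_of_ne_zero h' hne
  -- The hypothesis concerns only the reference table, so the two tables can exchange roles.
  · by_cases hne' : α' ≠ 0 ∨ β' ≠ 0
    · have := h'.parameters_eq_or_swap_of_ne_zero h hne'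
      tauto
    · push Not at hne hne'
      simp [hne, hne']

/-- The null vectors form a plane with zero product, common to both bases. A nonzero idempotent is
`e 2` plus a vector of this plane, so it acts on the plane as `e 2` does. The two matrices are
therefore conjugate: they share trace and determinant, and one is scalar only if the other is. -/
theorem similar (h : IsTable e 0 0 1 0 a b c d) (h' : IsTable e' 0 0 1 0 a' b' c' d') :
    a + d = a' + d' ∧ a * d - b * c = a' * d' - b' * c' ∧
      (b = 0 → c = 0 → a = d → b' = 0 ∧ c' = 0) := by
  have hp : e' 0 * e' 0 = 0 := by simp [h'.h00]
  have hq : e' 1 * e' 1 = 0 := by simp [h'.h11]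
  have hli := e'.pair_linearIndependent (i := 0) (j := 1) (by decide)
  have hrne := e'.ne_zero 2
  have hrr : e' 2 * e' 2 = e' 2 := by simp [h'.h22]
  have hpr := h'.h02
  have hqr := h'.h12
  generalize e' 0 = p at *
  generalize e' 1 = q at *
  generalize e' 2 = r at *
  rw [h.mul_self_eq_zero_iff] at hp hq
  have hp2 : e.repr p 2 = 0 := by simpa using hp.2.2
  have hq2 : e.repr q 2 = 0 := by simpa using hq.2.2
  rw [Ne, e.eq_zero_iff_three] at hrne
  rw [e.eq_iff_three, h.repr_mul_zero, h.repr_mul_one, h.repr_mul_two] at hrr hpr hqr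
  have hr2 : e.repr r 2 = 1 := by
    have : e.repr r 2 ≠ 0 := fun h0 => hrne (by simp [h0] at hrr; simp [h0, ← hrr])
    exact mul_left_cancel₀ this (by simpa using hrr.2.2)
  simp only [map_smul, map_add, Finsupp.add_apply, Finsupp.smul_apply, smul_eq_mul, hp2, hq2, hr2,
    mul_zero, zero_mul, add_zero, zero_add, mul_one] at hpr hqr
  have hdet : e.repr p 0 * e.repr q 1 - e.repr p 1 * e.repr q 0 ≠ 0 := by
    intro h0
    rw [e.pair_linearIndependent_iff] at hli
    have h1 := hli (e.repr q 0) (-e.repr p 0)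
    have h2 := hli (e.repr q 1) (-e.repr p 1)
    have h3 := hli 1 0
    simp only [hp2, hq2] at h1 h2 h3
    grind
  obtain ⟨hp0, hp1, -⟩ := hpr
  obtain ⟨hq0, hq1, -⟩ := hqr
  generalize e.repr p 0 = p0 at *
  generalize e.repr p 1 = p1 at *
  generalize e.repr q 0 = q0 at *
  generalize e.repr q 1 = q1 at *
  refine ⟨mul_left_cancel₀ hdet ?_, mul_left_cancel₀ hdet ?_, ?_⟩
  -- With P the matrix of columns p, q, the hypotheses say MP = PM'. This is the trace after
  -- multiplying by the adjugate of P; next comes det(MP) = det(PM').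
  · linear_combination q1 * hp0 - q0 * hp1 - p1 * hq0 + p0 * hq1
  · linear_combination (c * q0 + d * q1) * hp0 - (c * p0 + d * p1) * hq0
      + (a' * p0 + c' * q0) * hq1 - (b' * p0 + d' * q0) * hp1
  · rintro rfl rfl rfl
    constructor
    · exact mul_left_cancel₀ hdet (by linear_combination -q1 * hq0 + q0 * hq1)
    · exact mul_left_cancel₀ hdet (by linear_combination p1 * hp0 - p0 * hp1)

/-- The null line fixes `e' 0` up to scale, its square root `e' 1` lies in the span of `e 0` and `e
1` off that line, and the idempotent has third coordinate 1. So α is read off on the null line and β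
modulo it. -/
theorem parameters_eq (h : IsTable e 0 1 1 0 α 0 0 β) (h' : IsTable e' 0 1 1 0 α' 0 0 β') :
    α' = α ∧ β' = β := by
  have hp : e' 0 * e' 0 = 0 := by simp [h'.h00]
  have hpne := e'.ne_zero 0
  have hqq : e' 1 * e' 1 = e' 0 := by simp [h'.h11]
  have hrne := e'.ne_zero 2
  have hrr : e' 2 * e' 2 = e' 2 := by simp [h'.h22]
  have hpr : e' 0 * e' 2 = α' • e' 0 := by simp [h'.h02]
  have hqr : e' 1 * e' 2 = β' • e' 1 := by simp [h'.h12]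
  generalize e' 0 = p at *
  generalize e' 1 = q at *
  generalize e' 2 = r at *
  rw [h.mul_self_eq_zero_iff] at hp
  have hp2 : e.repr p 2 = 0 := by simpa using hp.2.2
  have hp1 : e.repr p 1 = 0 := by simpa [hp2] using hp.1
  rw [Ne, e.eq_zero_iff_three] at hrne hpne
  rw [e.eq_iff_three, h.repr_mul_zero, h.repr_mul_one, h.repr_mul_two] at hqq hrr hpr hqr
  have hp0 : e.repr p 0 ≠ 0 := by simpa [hp1, hp2] using hpne
  have hq2 : e.repr q 2 = 0 := by simpa [hp2] using hqq.2.2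
  have hq1 : e.repr q 1 ≠ 0 := by
    intro h0
    apply hp0
    simpa [h0, hq2, eq_comm] using hqq.1
  have hr2 : e.repr r 2 = 1 := by
    have : e.repr r 2 ≠ 0 := fun h0 => by
      have h1 : e.repr r 1 = 0 := by simpa [h0, eq_comm] using hrr.2.1
      have h2 : e.repr r 0 = 0 := by simpa [h0, h1, eq_comm] using hrr.1
      exact hrne ⟨h2, h1, h0⟩
    exact mul_left_cancel₀ this (by simpa using hrr.2.2)
  simp only [map_smul, Finsupp.smul_apply, smul_eq_mul, hp1, hp2, hq2, hr2, mul_zero, zero_mul,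
    add_zero, zero_add, mul_one] at hpr hqr
  exact ⟨(mul_right_cancel₀ hp0 hpr.1).symm, (mul_right_cancel₀ hq1 hqr.2.1).symm⟩

end IsTable

end Parameters

/-! ### Disjointness inside the three families with recovered parameters. -/

section Classes

variable {A : Type*} [NonUnitalNonAssocCommRing A] [Module ℝ A] {i j : ℕ}

/-- For A7 the order α < β is weakened to α ≠ β: it only selects a representative, and the recovered
pair is unordered. -/
theorem IsOfClass.exists_table_of_le_seven (h : IsOfClass A i) (hi : i ≤ 7) :
    ∃ (e : Module.Basis (Fin 3) ℝ A) (α β : ℝ), IsTable e 0 0 1 1 α 0 0 β ∧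
      ((i = 1 ∧ α = 0 ∧ β = 0) ∨ (i = 2 ∧ α = 0 ∧ β = 1 / 2) ∨ (i = 3 ∧ α = 1 / 2 ∧ β = 1 / 2) ∨
      (i = 4 ∧ α ≠ 0 ∧ α ≠ 1 / 2 ∧ β = 0) ∨ (i = 5 ∧ α ≠ 0 ∧ α ≠ 1 / 2 ∧ β = 1 / 2) ∨
      (i = 6 ∧ α ≠ 0 ∧ α ≠ 1 / 2 ∧ α = β) ∨
      (i = 7 ∧ α ≠ 0 ∧ α ≠ 1 / 2 ∧ β ≠ 0 ∧ β ≠ 1 / 2 ∧ α ≠ β)) := by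
  interval_cases i <;> simp only [IsOfClass, isAlgA1_iff] at h
  · obtain ⟨e, h⟩ := h; exact ⟨e, _, _, h, by simp⟩
  · obtain ⟨e, h⟩ := h; exact ⟨e, _, _, h, by simp⟩
  · obtain ⟨e, h⟩ := h; exact ⟨e, _, _, h, by simp⟩
  · obtain ⟨α, h0, h1, e, h⟩ := h; exact ⟨e, _, _, h, by simp_all⟩
  · obtain ⟨α, h0, h1, e, h⟩ := h; exact ⟨e, _, _, h, by simp_all⟩
  · obtain ⟨α, h0, h1, e, h⟩ := h; exact ⟨e, _, _, h, by simp_all⟩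
  · obtain ⟨α, β, h0, h1, h2, h3, h4, e, h⟩ := h; exact ⟨e, _, _, h, by simp_all [h4.ne]⟩

theorem IsOfClass.exists_table_square_zero_plane (h : IsOfClass A i)
    (hi : (8 ≤ i ∧ i ≤ 14) ∨ i = 22 ∨ i = 23) :
    ∃ (e : Module.Basis (Fin 3) ℝ A) (a b c d : ℝ), IsTable e 0 0 1 0 a b c d ∧
      ((b = 0 ∧ c = 0 ∧
        ((i = 8 ∧ a = 0 ∧ d = 0) ∨ (i = 9 ∧ a = 0 ∧ d = 1 / 2) ∨ (i = 10 ∧ a = 1 / 2 ∧ d = 1 / 2) ∨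
        (i = 11 ∧ a = 0 ∧ d ≠ 0 ∧ d ≠ 1 / 2) ∨ (i = 12 ∧ a = 1 / 2 ∧ d ≠ 0 ∧ d ≠ 1 / 2) ∨
        (i = 13 ∧ a ≠ 0 ∧ a ≠ 1 / 2 ∧ a = d) ∨
        (i = 14 ∧ a ≠ 0 ∧ a ≠ 1 / 2 ∧ d ≠ 0 ∧ d ≠ 1 / 2 ∧ a ≠ d))) ∨
      (i = 22 ∧ a = 0 ∧ b = 1 ∧ c = 0 ∧ d = 0) ∨
      (i = 23 ∧ a = d ∧ c = -b ∧ b ≠ 0)) := by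
  rcases hi with ⟨hi, hi'⟩ | rfl | rfl
  · interval_cases i <;> simp only [IsOfClass, isAlgA2_iff] at h
    · obtain ⟨e, h⟩ := h; exact ⟨e, _, _, _, _, h, by simp⟩
    · obtain ⟨e, h⟩ := h; exact ⟨e, _, _, _, _, h, by simp⟩
    · obtain ⟨e, h⟩ := h; exact ⟨e, _, _, _, _, h, by simp⟩
    · obtain ⟨β, h0, h1, e, h⟩ := h; exact ⟨e, _, _, _, _, h, by simp_all⟩
    · obtain ⟨β, h0, h1, e, h⟩ := h; exact ⟨e, _, _, _, _, h, by simp_all⟩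
    · obtain ⟨α, h0, h1, e, h⟩ := h; exact ⟨e, _, _, _, _, h, by simp_all⟩
    · obtain ⟨α, β, h0, h1, h2, h3, h4, e, h⟩ := h
      exact ⟨e, _, _, _, _, h, by simp_all [h4.ne]⟩
  · obtain ⟨e, h⟩ := isAlgJordan_iff.1 h; exact ⟨e, _, _, _, _, h, by simp⟩
  · obtain ⟨a, b, hb, h⟩ := h
    obtain ⟨e, h⟩ := isAlgA5_iff.1 h
    exact ⟨e, _, _, _, _, h, by simp [hb.ne']⟩

theorem IsOfClass.exists_table_square_line (h : IsOfClass A i) (hi : 24 ≤ i) (hi' : i ≤ 31) :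
    ∃ (e : Module.Basis (Fin 3) ℝ A) (α β : ℝ), IsTable e 0 1 1 0 α 0 0 β ∧
      ((i = 24 ∧ α = 0 ∧ β ≠ 0 ∧ β ≠ 1 / 2) ∨ (i = 25 ∧ α = 0 ∧ β = 0) ∨
      (i = 26 ∧ α = 0 ∧ β = 1 / 2) ∨
      (i = 27 ∧ α ≠ 0 ∧ α ≠ 1 / 2 ∧ β ≠ 0 ∧ β ≠ 1 / 2 ∧ α ≠ β) ∨
      (i = 28 ∧ α ≠ 0 ∧ α ≠ 1 / 2 ∧ α = β) ∨ (i = 29 ∧ α ≠ 0 ∧ α ≠ 1 / 2 ∧ β = 1 / 2) ∨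
      (i = 30 ∧ α = 1 / 2 ∧ β = 1 / 2) ∨ (i = 31 ∧ α = 1 / 2 ∧ β ≠ 0 ∧ β ≠ 1 / 2)) := by
  interval_cases i <;> simp only [IsOfClass, isAlgA6_iff] at h
  · obtain ⟨β, h0, h1, e, h⟩ := h; exact ⟨e, _, _, h, by simp_all⟩
  · obtain ⟨e, h⟩ := h; exact ⟨e, _, _, h, by simp⟩
  · obtain ⟨e, h⟩ := h; exact ⟨e, _, _, h, by simp⟩
  · obtain ⟨α, β, h0, h1, h2, h3, h4, e, h⟩ := h; exact ⟨e, _, _, h, by simp_all⟩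
  · obtain ⟨α, h0, h1, e, h⟩ := h; exact ⟨e, _, _, h, by simp_all⟩
  · obtain ⟨α, h0, h1, e, h⟩ := h; exact ⟨e, _, _, h, by simp_all⟩
  · obtain ⟨e, h⟩ := h; exact ⟨e, _, _, h, by simp⟩
  · obtain ⟨β, h0, h1, e, h⟩ := h; exact ⟨e, _, _, h, by simp_all⟩

variable [IsScalarTower ℝ A A] [SMulCommClass ℝ A A]

theorem IsOfClass.eq_of_le_seven (hi : IsOfClass A i) (hj : IsOfClass A j)
    (hi7 : i ≤ 7) (hj7 : j ≤ 7) : i = j := by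
  obtain ⟨e, α, β, h, H⟩ := hi.exists_table_of_le_seven hi7
  obtain ⟨e', α', β', h', H'⟩ := hj.exists_table_of_le_seven hj7
  rcases h.parameters_eq_or_swap h' with ⟨rfl, rfl⟩ | ⟨rfl, rfl⟩
  · clear h h' hi hj; grind
  · clear h h' hi hj; grind

theorem IsOfClass.eq_of_square_zero_plane (hi : IsOfClass A i) (hj : IsOfClass A j)
    (hi' : (8 ≤ i ∧ i ≤ 14) ∨ i = 22 ∨ i = 23) (hj' : (8 ≤ j ∧ j ≤ 14) ∨ j = 22 ∨ j = 23) :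
    i = j := by
  obtain ⟨e, a, b, c, d, h, H⟩ := hi.exists_table_square_zero_plane hi'
  obtain ⟨e', a', b', c', d', h', H'⟩ := hj.exists_table_square_zero_plane hj'
  obtain ⟨htr, hdet, hs⟩ := h.similar h'
  obtain ⟨-, -, hs'⟩ := h'.similar h
  clear h h' hi hj
  rcases H with ⟨rfl, rfl, H⟩ | ⟨rfl, rfl, rfl, rfl, rfl⟩ | ⟨rfl, rfl, rfl, hb⟩ <;>
    rcases H' with ⟨rfl, rfl, H'⟩ | ⟨rfl, rfl, rfl, rfl, rfl⟩ | ⟨rfl, rfl, rfl, hb'⟩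
  · have : (a = a' ∧ d = d') ∨ (a = d' ∧ d = a') := by
      -- The eigenvalue a is a root of the other characteristic polynomial.
      have : (a - a') * (a - d') = 0 := by linear_combination a * htr - hdet
      rcases mul_eq_zero.1 this with h | h
      · left; constructor <;> linarith
      · right; constructor <;> linarith
    clear htr hdet hs hs'
    rcases this with ⟨rfl, rfl⟩ | ⟨rfl, rfl⟩ <;> grind
  -- Trace and determinant zero make the diagonal matrix zero, hence scalar, unlike the Jordan
  -- block.
  · have ha : a = 0 := by nlinarith
    have hd : d = 0 := by nlinarith
    simpa using hs rfl rfl (by rw [ha, hd])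
  -- Comparison of discriminants: (a - d)² for the diagonal matrix, -4b'² for the rotation type.
  · have : (a - d) ^ 2 + 4 * b' ^ 2 = 0 := by
      linear_combination (a + d + 2 * a') * htr - 4 * hdet
    nlinarith [sq_nonneg (a - d), sq_pos_of_ne_zero hb']
  · have ha : a' = 0 := by nlinarith
    have hd : d' = 0 := by nlinarith
    simpa using hs' rfl rfl (by rw [ha, hd])
  · rfl
  · nlinarith [sq_pos_of_ne_zero hb']
  · have : (a' - d') ^ 2 + 4 * b ^ 2 = 0 := by
      linear_combination 4 * hdet - (a' + d' + 2 * a) * htr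
    nlinarith [sq_nonneg (a' - d'), sq_pos_of_ne_zero hb]
  · nlinarith [sq_pos_of_ne_zero hb]
  · rfl

theorem IsOfClass.eq_of_square_line (hi : IsOfClass A i) (hj : IsOfClass A j)
    (hi1 : 24 ≤ i) (hi2 : i ≤ 31) (hj1 : 24 ≤ j) (hj2 : j ≤ 31) : i = j := by
  obtain ⟨e, α, β, h, H⟩ := hi.exists_table_square_line hi1 hi2
  obtain ⟨e', α', β', h', H'⟩ := hj.exists_table_square_line hj1 hj2
  obtain ⟨rfl, rfl⟩ := h.parameters_eq h'
  clear h h' hi hj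
  grind

end Classes

/-! ### Separating the families and the classes without an idempotent. -/

section Separation

variable {A : Type*} [NonUnitalNonAssocCommRing A] [Module ℝ A] {i j : ℕ}

theorem IsOfClass.hasNullFactoredIdempotent (h : IsOfClass A i) (hi : i ≤ 7) :
    HasNullFactoredIdempotent A := by
  obtain ⟨e, α, β, h, -⟩ := h.exists_table_of_le_seven hi
  exact h.hasNullFactoredIdempotent

variable [IsScalarTower ℝ A A] [SMulCommClass ℝ A A]

theorem IsOfClass.invariants_of_square_zero_plane (h : IsOfClass A i)
    (hi : (8 ≤ i ∧ i ≤ 14) ∨ i = 22 ∨ i = 23) :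
    HasIdempotent A ∧ ¬ HasNullFactoredIdempotent A ∧ HasNullPlane A := by
  obtain ⟨e, a, b, c, d, h, -⟩ := h.exists_table_square_zero_plane hi
  exact ⟨h.hasIdempotent, h.not_hasNullFactoredIdempotent, h.hasNullPlane⟩

theorem IsOfClass.invariants_of_square_line (h : IsOfClass A i) (hi : 24 ≤ i) (hi' : i ≤ 31) :
    HasIdempotent A ∧ ¬ HasNullFactoredIdempotent A ∧ ¬ HasNullPair A := by
  obtain ⟨e, a, b, h, -⟩ := h.exists_table_square_line hi hi'
  exact ⟨h.hasIdempotent, h.not_hasNullFactoredIdempotent, h.not_hasNullPair⟩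

theorem IsOfClass.invariants_of_seventeen (h : IsOfClass A 17) :
    HasIdempotent A ∧ ¬ HasNullFactoredIdempotent A ∧ HasNullPair A ∧ ¬ HasNullPlane A := by
  obtain ⟨e, h⟩ := isAlgA3_iff.1 h
  exact ⟨h.hasIdempotent_of_eq_one,
    h.not_hasNullFactoredIdempotent_of_axes one_ne_zero one_ne_zero, h.hasNullPair,
    h.not_hasNullPlane_of_axes one_ne_zero one_ne_zero⟩

theorem IsOfClass.invariants_of_fifteen (h : IsOfClass A 15) :
    ¬ HasIdempotent A ∧ HasNullPlane A ∧ TripleProductsVanish A ∧ ¬ HasAnnihilatorPair A := by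
  obtain ⟨e, h⟩ := isAlgA3_iff.1 h
  exact ⟨h.not_hasIdempotent_of_ne (.inr rfl), h.hasNullPlane_of_zero_two,
    h.tripleProductsVanish (.inl rfl), h.not_hasAnnihilatorPair⟩

theorem IsOfClass.invariants_of_sixteen (h : IsOfClass A 16) :
    ¬ HasIdempotent A ∧ HasNullPlane A ∧ ¬ TripleProductsVanish A ∧ ¬ HasAnnihilator A ∧
      ¬ IsMetabelian A := by
  obtain ⟨e, h⟩ := isAlgA3_iff.1 h
  exact ⟨h.not_hasIdempotent_of_ne (.inr rfl), h.hasNullPlane_of_zero_two,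
    h.not_tripleProductsVanish_of_right, h.not_hasAnnihilator one_ne_zero (.inr one_ne_zero),
    h.not_isMetabelian⟩

theorem IsOfClass.invariants_of_eighteen (h : IsOfClass A 18) :
    ¬ HasIdempotent A ∧ ¬ HasNullPlane A ∧ HasNullTriangle A := by
  obtain ⟨β, hβ, h⟩ := h
  obtain ⟨e, h⟩ := isAlgA3_iff.1 h
  have hβ0 : β ≠ 0 := (zero_lt_one.trans hβ).ne'
  exact ⟨h.not_hasIdempotent_of_ne (.inl hβ.ne), h.not_hasNullPlane_of_axes one_ne_zero hβ0,
    h.hasNullTriangle one_ne_zero hβ0⟩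

theorem IsOfClass.invariants_of_nineteen (h : IsOfClass A 19) :
    ¬ HasIdempotent A ∧ HasNullPlane A ∧ ¬ TripleProductsVanish A ∧ HasAnnihilator A ∧
      ¬ HasSquareAnnihilator A := by
  obtain ⟨e, h⟩ := isAlgA4_iff.1 h
  exact ⟨h.not_hasIdempotent, h.hasNullPlane, h.not_tripleProductsVanish_of_right,
    h.hasAnnihilator_of_left, h.not_hasSquareAnnihilator⟩

theorem IsOfClass.invariants_of_twenty (h : IsOfClass A 20) :
    ¬ HasIdempotent A ∧ HasNullPlane A ∧ ¬ TripleProductsVanish A ∧ ¬ HasAnnihilator A ∧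
      IsMetabelian A ∧ FixesPair A := by
  obtain ⟨e, h⟩ := isAlgA4_iff.1 h
  exact ⟨h.not_hasIdempotent, h.hasNullPlane, h.not_tripleProductsVanish_of_right,
    h.not_hasAnnihilator one_ne_zero (.inl one_ne_zero), h.isMetabelian, h.fixesPair⟩

theorem IsOfClass.invariants_of_twentyOne (h : IsOfClass A 21) :
    ¬ HasIdempotent A ∧ HasNullPlane A ∧ ¬ TripleProductsVanish A ∧ ¬ HasAnnihilator A ∧
      IsMetabelian A ∧ ¬ FixesPair A := by
  obtain ⟨β, h0, h1, h⟩ := h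
  obtain ⟨e, h⟩ := isAlgA4_iff.1 h
  exact ⟨h.not_hasIdempotent, h.hasNullPlane, h.not_tripleProductsVanish_of_left,
    h.not_hasAnnihilator h0 (.inl one_ne_zero), h.isMetabelian, h.not_fixesPair h1⟩

theorem IsOfClass.invariants_of_thirtyTwo (h : IsOfClass A 32) :
    ¬ HasIdempotent A ∧ HasNullPlane A ∧ TripleProductsVanish A ∧ HasAnnihilatorPair A := by
  obtain ⟨e, h⟩ := isAlgA7_iff.1 h
  exact ⟨h.not_hasIdempotent, h.hasNullPlane_of_right_zero, h.tripleProductsVanish (.inr rfl),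
    h.hasAnnihilatorPair⟩

theorem IsOfClass.invariants_of_thirtyThree (h : IsOfClass A 33) :
    ¬ HasIdempotent A ∧ ¬ HasNullPlane A ∧ ¬ HasNullTriangle A ∧ ¬ FixesPair A := by
  obtain ⟨β, h0, h1, h⟩ := h
  obtain ⟨e, h⟩ := isAlgA7_iff.1 h
  exact ⟨h.not_hasIdempotent, h.not_hasNullPlane h0, h.not_hasNullTriangle h0, h.not_fixesPair h1⟩

theorem IsOfClass.invariants_of_thirtyFour (h : IsOfClass A 34) :
    ¬ HasIdempotent A ∧ ¬ HasNullPlane A ∧ ¬ HasNullTriangle A ∧ FixesPair A := by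
  obtain ⟨e, h⟩ := isAlgA7_iff.1 h
  exact ⟨h.not_hasIdempotent, h.not_hasNullPlane one_ne_zero, h.not_hasNullTriangle one_ne_zero,
    h.fixesPair⟩

theorem IsOfClass.invariants_of_thirtyFive (h : IsOfClass A 35) :
    ¬ HasIdempotent A ∧ HasNullPlane A ∧ ¬ TripleProductsVanish A ∧ HasAnnihilator A ∧
      HasSquareAnnihilator A := by
  obtain ⟨e, h⟩ := isAlgA7_iff.1 h
  exact ⟨h.not_hasIdempotent, h.hasNullPlane_of_right_zero, h.not_tripleProductsVanish_of_left,
    h.hasAnnihilator_of_right, h.hasSquareAnnihilator⟩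

/-- A decision tree. Without a null plane: 18 has a null triangle, and a fixed pair separates 34
from 33. With one: the size of the annihilator separates 15 from 32 when triple products vanish;
otherwise a nonzero annihilator leaves 19 and 35, and a zero one leaves 16, 20 and 21. -/
theorem IsOfClass.invariants_without_idempotent (h : IsOfClass A i)
    (hi : i = 15 ∨ i = 16 ∨ i = 18 ∨ i = 19 ∨ i = 20 ∨ i = 21 ∨ i = 32 ∨ i = 33 ∨ i = 34 ∨
      i = 35) :
    ¬ HasIdempotent A ∧
    ((i = 15 ∧ HasNullPlane A ∧ TripleProductsVanish A ∧ ¬ HasAnnihilatorPair A) ∨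
    (i = 16 ∧ HasNullPlane A ∧ ¬ TripleProductsVanish A ∧ ¬ HasAnnihilator A ∧
      ¬ IsMetabelian A) ∨
    (i = 18 ∧ ¬ HasNullPlane A ∧ HasNullTriangle A) ∨
    (i = 19 ∧ HasNullPlane A ∧ ¬ TripleProductsVanish A ∧ HasAnnihilator A ∧
      ¬ HasSquareAnnihilator A) ∨
    (i = 20 ∧ HasNullPlane A ∧ ¬ TripleProductsVanish A ∧ ¬ HasAnnihilator A ∧
      IsMetabelian A ∧ FixesPair A) ∨
    (i = 21 ∧ HasNullPlane A ∧ ¬ TripleProductsVanish A ∧ ¬ HasAnnihilator A ∧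
      IsMetabelian A ∧ ¬ FixesPair A) ∨
    (i = 32 ∧ HasNullPlane A ∧ TripleProductsVanish A ∧ HasAnnihilatorPair A) ∨
    (i = 33 ∧ ¬ HasNullPlane A ∧ ¬ HasNullTriangle A ∧ ¬ FixesPair A) ∨
    (i = 34 ∧ ¬ HasNullPlane A ∧ ¬ HasNullTriangle A ∧ FixesPair A) ∨
    (i = 35 ∧ HasNullPlane A ∧ ¬ TripleProductsVanish A ∧ HasAnnihilator A ∧
      HasSquareAnnihilator A)) := by
  rcases hi with rfl | rfl | rfl | rfl | rfl | rfl | rfl | rfl | rfl | rfl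
  · simpa using h.invariants_of_fifteen
  · simpa using h.invariants_of_sixteen
  · simpa using h.invariants_of_eighteen
  · simpa using h.invariants_of_nineteen
  · simpa using h.invariants_of_twenty
  · simpa using h.invariants_of_twentyOne
  · simpa using h.invariants_of_thirtyTwo
  · simpa using h.invariants_of_thirtyThree
  · simpa using h.invariants_of_thirtyFour
  · simpa using h.invariants_of_thirtyFive

theorem IsOfClass.eq_of_without_idempotent (hi : IsOfClass A i) (hj : IsOfClass A j)
    (hi' : i = 15 ∨ i = 16 ∨ i = 18 ∨ i = 19 ∨ i = 20 ∨ i = 21 ∨ i = 32 ∨ i = 33 ∨ i = 34 ∨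
      i = 35)
    (hj' : j = 15 ∨ j = 16 ∨ j = 18 ∨ j = 19 ∨ j = 20 ∨ j = 21 ∨ j = 32 ∨ j = 33 ∨ j = 34 ∨
      j = 35) : i = j := by
  obtain ⟨-, H⟩ := hi.invariants_without_idempotent hi'
  obtain ⟨-, H'⟩ := hj.invariants_without_idempotent hj'
  clear hi hj hi' hj'
  grind

/-- The five families into which the classes fall, with the invariants that separate them. -/
theorem IsOfClass.family (h : IsOfClass A i) (hi : i ∈ Set.Icc 1 35) :
    (i ≤ 7 ∧ HasNullFactoredIdempotent A) ∨
    (((8 ≤ i ∧ i ≤ 14) ∨ i = 22 ∨ i = 23) ∧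
      HasIdempotent A ∧ ¬ HasNullFactoredIdempotent A ∧ HasNullPlane A) ∨
    ((24 ≤ i ∧ i ≤ 31) ∧ HasIdempotent A ∧ ¬ HasNullFactoredIdempotent A ∧ ¬ HasNullPair A) ∨
    (i = 17 ∧
      HasIdempotent A ∧ ¬ HasNullFactoredIdempotent A ∧ HasNullPair A ∧ ¬ HasNullPlane A) ∨
    ((i = 15 ∨ i = 16 ∨ i = 18 ∨ i = 19 ∨ i = 20 ∨ i = 21 ∨ i = 32 ∨ i = 33 ∨ i = 34 ∨
      i = 35) ∧ ¬ HasIdempotent A) := by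
  obtain ⟨hi1, hi2⟩ := hi
  have : i ≤ 7 ∨ ((8 ≤ i ∧ i ≤ 14) ∨ i = 22 ∨ i = 23) ∨ (24 ≤ i ∧ i ≤ 31) ∨ i = 17 ∨
      (i = 15 ∨ i = 16 ∨ i = 18 ∨ i = 19 ∨ i = 20 ∨ i = 21 ∨ i = 32 ∨ i = 33 ∨ i = 34 ∨
      i = 35) := by omega
  rcases this with h1 | h1 | h1 | rfl | h1
  · exact .inl ⟨h1, h.hasNullFactoredIdempotent h1⟩
  · exact .inr (.inl ⟨h1, h.invariants_of_square_zero_plane h1⟩)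
  · exact .inr (.inr (.inl ⟨h1, h.invariants_of_square_line h1.1 h1.2⟩))
  · exact .inr (.inr (.inr (.inl ⟨rfl, h.invariants_of_seventeen⟩)))
  · exact .inr (.inr (.inr (.inr ⟨h1, (h.invariants_without_idempotent h1).1⟩)))

theorem IsOfClass.index_unique (hAi : IsOfClass A i) (hAj : IsOfClass A j)
    (hi : i ∈ Set.Icc 1 35) (hj : j ∈ Set.Icc 1 35) : i = j := by
  -- These two implications make any two different families propositionally contradictory.
  have hE := HasNullFactoredIdempotent.hasIdempotent (A := A)
  have hP := HasNullPlane.hasNullPair (A := A)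
  rcases hAi.family hi with ⟨h1, H⟩ | ⟨h1, H⟩ | ⟨h1, H⟩ | ⟨h1, H⟩ | ⟨h1, H⟩ <;>
    rcases hAj.family hj with ⟨h2, H'⟩ | ⟨h2, H'⟩ | ⟨h2, H'⟩ | ⟨h2, H'⟩ | ⟨h2, H'⟩ <;>
    first
    | exact hAi.eq_of_le_seven hAj h1 h2
    | exact hAi.eq_of_square_zero_plane hAj h1 h2
    | exact hAi.eq_of_square_line hAj h1.1 h1.2 h2.1 h2.2
    | exact h1.trans h2.symm
    | exact hAi.eq_of_without_idempotent hAj h1 h2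
    | (exfalso; clear h1 h2; tauto)

end Separation

theorem theorem2 {A B : Type*}
    [NonUnitalNonAssocCommRing A] [Module ℝ A] [IsScalarTower ℝ A A] [SMulCommClass ℝ A A]
    [NonUnitalNonAssocCommRing B] [Module ℝ B] [IsScalarTower ℝ B B] [SMulCommClass ℝ B B]
    (i j : ℕ) (hi : i ∈ Set.Icc 1 35) (hj : j ∈ Set.Icc 1 35) (hij : i ≠ j)
    (hA : IsOfClass A i) (hB : IsOfClass B j) :
    ¬ AlgIsomorphic A B := by
  rintro ⟨f, hf⟩
  exact hij (hA.index_unique (hB.of_linearEquiv f hf) hi hj)
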